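/- Let $\mathbb{Z}[i]$ be the ring of Gaussian integers, and call a solution $(x,y)$ of either equation below nontrivial if $xy\neq 0$. (1) Every solution $(x,y)\in\mathbb{Z}[i]^2$ of $x^2-y^3=1$ satisfies $x,y\in\mathbb{Z}$; its nontrivial solutions in $\mathbb{Z}[i]^2$ are exactly $(3,2)$ and $(-3,2)$. (2) The nontrivial solutions $(x,y)\in\mathbb{Z}[i]^2$ of $x^3-y^2=1$ are exactly $(-2,3i)$ and $(-2,-3i)$. -/

import Mathlib

/-! Write x^2 = (y+1)(y^2-y+1). The gcd of the factors divides 3, so both are squares or both are 3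
times squares, up to a common factor i that congruences modulo 4 exclude (`sq_split`,
`sq_mod_four`). Both cases give a point of w^2 = u^4 - 3u^2v^2 + 3v^4 with u = 1 or v = 1, and
`quartic_solutions` forces v = 0 or u^2 = v^2.

The quartic is handled by a descent of 2-isogeny type. From 4w^2 = (2u^2-3v^2)^2 + 3v^4, a
factorization of 3v^4 yields a point of the companion quartic s^4 + 6s^2t^2 - 3t^4. Writing the
latter as (s^2+3t^2)^2 - 12t^4 leads back to the first quartic with a new v dividing the old one.
The descent only stops at unit solutions. Parity at 1+i dictates the case splits.

The second equation becomes the first under (x, y) ↦ (iy, -x). -/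

namespace GaussianInt

/-! ### Units and the primes 1+i and 3 -/

/-- The imaginary unit. -/
abbrev I : GaussianInt := ⟨0, 1⟩

lemma I_mul_I : I * I = -1 := by decide

lemma I_sq : I ^ 2 = -1 := by rw [sq, I_mul_I]

lemma isUnit_cases {e : GaussianInt} (he : IsUnit e) : e = 1 ∨ e = -1 ∨ e = I ∨ e = -I := by
  have h := (Zsqrtd.norm_eq_one_iff' (by norm_num) e).mpr he
  rw [Zsqrtd.norm_def] at h
  have h1 : e.re ≤ 1 := by nlinarith [mul_self_nonneg e.im]
  have h2 : -1 ≤ e.re := by nlinarith [mul_self_nonneg e.im]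
  have h3 : e.im ≤ 1 := by nlinarith [mul_self_nonneg e.re]
  have h4 : -1 ≤ e.im := by nlinarith [mul_self_nonneg e.re]
  rcases e with ⟨a, b⟩
  simp only at h h1 h2 h3 h4
  interval_cases a <;> interval_cases b <;> first | omega | decide

lemma IsUnit.pow_four {e : GaussianInt} (he : IsUnit e) : e ^ 4 = 1 := by
  rcases isUnit_cases he with rfl | rfl | rfl | rfl <;> decide

lemma IsUnit.sq_eq {e : GaussianInt} (he : IsUnit e) : e ^ 2 = 1 ∨ e ^ 2 = -1 := by
  rcases isUnit_cases he with rfl | rfl | rfl | rfl <;> decide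

lemma isUnit_I : IsUnit I := IsUnit.of_mul_eq_one (-I) (by decide)

/-- The prime above `2`. -/
abbrev pi : GaussianInt := ⟨1, 1⟩

lemma pi_sq : pi ^ 2 = 2 * I := by decide

lemma pi_dvd_iff (s : GaussianInt) : pi ∣ s ↔ (s.re + s.im) % 2 = 0 := by
  constructor
  · rintro ⟨k, rfl⟩
    simp [Zsqrtd.re_mul, Zsqrtd.im_mul]
    omega
  · intro h
    refine ⟨⟨(s.re + s.im) / 2, (s.im - s.re) / 2⟩, ?_⟩
    ext <;> simp [Zsqrtd.re_mul, Zsqrtd.im_mul] <;> omega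

lemma not_isUnit_pi : ¬ IsUnit pi := by
  intro h
  rcases isUnit_cases h with h | h | h | h <;> revert h <;> decide

lemma prime_pi : Prime pi := by
  refine ⟨by decide, not_isUnit_pi, fun a b h => ?_⟩
  rw [pi_dvd_iff] at *
  rw [pi_dvd_iff]
  simp only [Zsqrtd.re_mul, Zsqrtd.im_mul] at h
  have h' : ((a.re + a.im) * (b.re + b.im)) % 2 = 0 := by
    have : (a.re + a.im) * (b.re + b.im) =
      (a.re * b.re + (-1) * a.im * b.im + (a.re * b.im + a.im * b.re)) + 2 * (a.im * b.im) := by ring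
    omega
  rcases Int.emod_two_eq_zero_or_one (a.re + a.im) with h1 | h1
  · exact Or.inl h1
  rcases Int.emod_two_eq_zero_or_one (b.re + b.im) with h2 | h2
  · exact Or.inr h2
  rw [Int.mul_emod, h1, h2] at h'
  omega

lemma prime_three : Prime (3 : GaussianInt) := by
  have : Fact (Nat.Prime 3) := ⟨by norm_num⟩
  exact_mod_cast prime_of_nat_prime_of_mod_four_eq_three 3 (by norm_num)

/-! ### Congruences modulo 2 and 4 -/

lemma two_dvd_iff (s : GaussianInt) : 2 ∣ s ↔ s.re % 2 = 0 ∧ s.im % 2 = 0 := by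
  have := Zsqrtd.intCast_dvd (d := -1) 2 s
  rw [← Int.dvd_iff_emod_eq_zero, ← Int.dvd_iff_emod_eq_zero]
  exact_mod_cast this

lemma four_dvd_iff (s : GaussianInt) : 4 ∣ s ↔ s.re % 4 = 0 ∧ s.im % 4 = 0 := by
  have := Zsqrtd.intCast_dvd (d := -1) 4 s
  rw [← Int.dvd_iff_emod_eq_zero, ← Int.dvd_iff_emod_eq_zero]
  exact_mod_cast this

/-- An odd Gaussian integer is `1` or `i` modulo `2`. -/
lemma odd_mod_two {s : GaussianInt} (hs : ¬ pi ∣ s) :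
    ∃ c k, (c = 1 ∨ c = I) ∧ s = c + 2 * k := by
  rw [pi_dvd_iff] at hs
  rcases Int.emod_two_eq_zero_or_one s.re with h | h
  · refine ⟨I, ⟨s.re / 2, s.im / 2⟩, Or.inr rfl, ?_⟩
    ext <;> simp [Zsqrtd.re_mul, Zsqrtd.im_mul] <;> omega
  · refine ⟨1, ⟨s.re / 2, s.im / 2⟩, Or.inl rfl, ?_⟩
    ext <;> simp [Zsqrtd.re_mul, Zsqrtd.im_mul] <;> omega

/-- The square of an odd Gaussian integer is `1` or `-1` modulo `4`. -/
lemma odd_sq_mod_four {s : GaussianInt} (hs : ¬ pi ∣ s) :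
    ∃ c k, (c = 1 ∨ c = -1) ∧ s ^ 2 = c + 4 * k := by
  obtain ⟨_, k, rfl | rfl, rfl⟩ := odd_mod_two hs
  · exact ⟨1, k + k ^ 2, Or.inl rfl, by ring⟩
  · exact ⟨-1, I * k + k ^ 2, Or.inr rfl, by linear_combination I_sq⟩

lemma odd_pow_four_mod_four {s : GaussianInt} (hs : ¬ pi ∣ s) : ∃ k, s ^ 4 = 1 + 4 * k := by
  obtain ⟨_, k, rfl | rfl, h⟩ := odd_sq_mod_four hs
  · exact ⟨2 * k + 4 * k ^ 2, by linear_combination (s ^ 2 + 1 + 4 * k) * h⟩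
  · exact ⟨-2 * k + 4 * k ^ 2, by linear_combination (s ^ 2 - 1 + 4 * k) * h⟩

lemma pow_four_mod_four (s : GaussianInt) : ∃ c k, (c = 0 ∨ c = 1) ∧ s ^ 4 = c + 4 * k := by
  by_cases hs : pi ∣ s
  · obtain ⟨k, rfl⟩ := hs
    -- (1+i)^4 = -4.
    exact ⟨0, -k ^ 4, Or.inl rfl, by
      linear_combination (pi ^ 2 + 2 * I) * k ^ 4 * pi_sq + 4 * k ^ 4 * I_sq⟩
  · obtain ⟨k, hk⟩ := odd_pow_four_mod_four hs
    exact ⟨1, k, Or.inr rfl, hk⟩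

/-- The square modulo 4 tells the odd classes 1 and i modulo 2 apart. -/
lemma two_dvd_sub_of_odd {x y : GaussianInt} (hx : ¬ pi ∣ x) (hy : ¬ pi ∣ y)
    (h : 4 ∣ x ^ 2 - y ^ 2) : 2 ∣ x - y := by
  obtain ⟨c, k, hc, rfl⟩ := odd_mod_two hx
  obtain ⟨d, l, hd, rfl⟩ := odd_mod_two hy
  have h4 : 4 ∣ c ^ 2 - d ^ 2 := by
    obtain ⟨m, hm⟩ := h
    exact ⟨m - c * k - k ^ 2 + d * l + l ^ 2, by linear_combination hm⟩
  rcases hc with rfl | rfl <;> rcases hd with rfl | rfl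
  · exact ⟨k - l, by ring⟩
  · rw [four_dvd_iff] at h4; exact absurd h4 (by decide)
  · rw [four_dvd_iff] at h4; exact absurd h4 (by decide)
  · exact ⟨k - l, by ring⟩

/-! ### Splitting coprime products into powers -/

lemma unit_mul_eq_one_cases {e f : GaussianInt} (he : IsUnit e) (h : e * f = 1) :
    (e = 1 ∧ f = 1) ∨ (e = -1 ∧ f = -1) ∨ (e = I ∧ f = -I) ∨ (e = -I ∧ f = I) := by
  rcases isUnit_cases he with rfl | rfl | rfl | rfl
  · exact Or.inl ⟨rfl, by linear_combination h⟩
  · exact Or.inr (Or.inl ⟨rfl, by linear_combination -h⟩)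
  · exact Or.inr (Or.inr (Or.inl ⟨rfl, by linear_combination -I * h + f * I_sq⟩))
  · exact Or.inr (Or.inr (Or.inr ⟨rfl, by linear_combination I * h + f * I_sq⟩))

lemma eq_one_or_eq_I_mul_sq {e : GaussianInt} (he : IsUnit e) :
    ∃ g, IsUnit g ∧ (e = g ^ 2 ∨ e = I * g ^ 2) := by
  rcases isUnit_cases he with rfl | rfl | rfl | rfl
  · exact ⟨1, isUnit_one, by decide⟩
  · exact ⟨I, isUnit_I, by decide⟩
  · exact ⟨1, isUnit_one, by decide⟩
  · exact ⟨I, isUnit_I, by decide⟩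

/-- Coprime factors of a square are squares up to a common unit. -/
lemma sq_split {p q x : GaussianInt} (hx : x ≠ 0) (hc : IsCoprime p q) (h : p * q = x ^ 2) :
    ∃ a b, (p = a ^ 2 ∧ q = b ^ 2) ∨ (p = I * a ^ 2 ∧ q = I * b ^ 2) := by
  obtain ⟨a, e, ha⟩ := exists_associated_pow_of_mul_eq_pow' hc h
  obtain ⟨b, f, hb⟩ := exists_associated_pow_of_mul_eq_pow' hc.symm (by rw [mul_comm, h])
  have h1 : Associated ((a * b) ^ 2) (x ^ 2) :=
    ⟨e * f, by rw [← h, ← ha, ← hb]; push_cast; ring⟩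
  obtain ⟨g, hg⟩ : Associated (a * b) x := by
    have hd : (a * b) ∣ x := (IsIntegrallyClosed.pow_dvd_pow_iff two_ne_zero).mp h1.dvd
    have hd' : x ∣ (a * b) := (IsIntegrallyClosed.pow_dvd_pow_iff two_ne_zero).mp h1.symm.dvd
    exact associated_of_dvd_dvd hd hd'
  have hab : (a * b) ^ 2 ≠ 0 := by
    intro h0
    apply hx
    rw [← hg, pow_eq_zero_iff two_ne_zero |>.mp h0, zero_mul]
  have hef : (e : GaussianInt) * f = g ^ 2 := by
    apply mul_left_cancel₀ hab
    rw [← mul_pow, hg, ← h, ← ha, ← hb]; ring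
  rw [← ha, ← hb]
  -- i is not a square of a unit, so e and f lie in the same class modulo unit squares.
  have key : ∀ c d : GaussianIntˣ, I * (c : GaussianInt) ^ 2 * (d : GaussianInt) ^ 2 ≠
      (g : GaussianInt) ^ 2 := by
    intro c d
    rcases IsUnit.sq_eq c.isUnit with hc | hc <;> rcases IsUnit.sq_eq d.isUnit with hd | hd <;>
      rcases IsUnit.sq_eq g.isUnit with hg | hg <;> rw [hc, hd, hg] <;> decide
  obtain ⟨_, ⟨c, rfl⟩, hc | hc⟩ := eq_one_or_eq_I_mul_sq e.isUnit <;>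
  obtain ⟨_, ⟨d, rfl⟩, hd | hd⟩ := eq_one_or_eq_I_mul_sq f.isUnit <;>
  rw [hc, hd] at hef ⊢
  · exact ⟨a * c, b * d, Or.inl ⟨by ring, by ring⟩⟩
  · exact absurd (by rw [← hef]; ring) (key c d)
  · exact absurd hef (key c d)
  · exact ⟨a * c, b * d, Or.inr ⟨by ring, by ring⟩⟩

/-- Units have fourth power 1, so absorbing a unit into b leaves b^4 alone and makes the two
remaining units exactly inverse. -/
lemma fourth_power_split_aux {p q z : GaussianInt} (hz : z ≠ 0) (hc : IsCoprime p q)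
    (h : p * q = z ^ 4) :
    ∃ e f a b : GaussianInt, IsUnit e ∧ e * f = 1 ∧ z = a * b ∧ p = e * a ^ 4 ∧ q = f * b ^ 4 := by
  obtain ⟨a, e, ha⟩ := exists_associated_pow_of_mul_eq_pow' hc h
  obtain ⟨b, f, hb⟩ := exists_associated_pow_of_mul_eq_pow' hc.symm (by rw [mul_comm, h])
  have h1 : Associated ((a * b) ^ 4) (z ^ 4) :=
    ⟨e * f, by rw [← h, ← ha, ← hb]; push_cast; ring⟩
  obtain ⟨g, hg⟩ : Associated (a * b) z :=
    associated_of_dvd_dvd ((IsIntegrallyClosed.pow_dvd_pow_iff four_ne_zero).mp h1.dvd)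
      ((IsIntegrallyClosed.pow_dvd_pow_iff four_ne_zero).mp h1.symm.dvd)
  have hg4 : (g : GaussianInt) ^ 4 = 1 := IsUnit.pow_four g.isUnit
  refine ⟨e, f, a, b * g, e.isUnit, ?_, by rw [← hg]; ring, by rw [← ha]; ring, ?_⟩
  · apply mul_left_cancel₀ (pow_ne_zero 4 hz)
    rw [mul_one]
    calc z ^ 4 * (e * f) = (a ^ 4 * e) * (b ^ 4 * f) * g ^ 4 := by rw [← hg]; ring
      _ = z ^ 4 := by rw [ha, hb, h, hg4, mul_one]
  · rw [mul_pow, hg4, ← hb]; ring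

/-- If `p * q = 3 * z ^ 4` and no prime factor of `z` divides both `p` and `q`, then `p` and `q`
are, in some order, `a ^ 4` and `3 * b ^ 4` up to inverse units, with `z = a * b`. -/
lemma fourth_power_split {p q z : GaussianInt} (hz : z ≠ 0) (h : p * q = 3 * z ^ 4)
    (hl : ∀ l : GaussianInt, Prime l → l ∣ z → l ∣ p → l ∣ q → False) :
    ∃ e f a b : GaussianInt, IsUnit e ∧ e * f = 1 ∧ z = a * b ∧ IsCoprime a b ∧
      ((p = e * a ^ 4 ∧ q = 3 * (f * b ^ 4)) ∨ (p = 3 * (f * b ^ 4) ∧ q = e * a ^ 4)) := by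
  have hc : IsCoprime p q := by
    refine isCoprime_of_prime_dvd ?_ fun l hp hlp hlq => ?_
    · rintro ⟨rfl, -⟩
      rw [zero_mul] at h
      exact mul_ne_zero prime_three.ne_zero (pow_ne_zero 4 hz) h.symm
    · refine hl l hp ?_ hlp hlq
      rcases hp.dvd_or_dvd (h ▸ hlp.mul_right q) with h3 | h3
      · have ha : (3 : GaussianInt) ∣ l := hp.irreducible.dvd_symm prime_three.irreducible h3
        obtain ⟨p', rfl⟩ := ha.trans hlp
        obtain ⟨q', rfl⟩ := ha.trans hlq
        have : (3 : GaussianInt) * (p' * q') = z ^ 4 :=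
          mul_left_cancel₀ prime_three.ne_zero (by linear_combination h)
        exact h3.trans (prime_three.dvd_of_dvd_pow ⟨_, this.symm⟩)
      · exact hp.dvd_of_dvd_pow h3
  have h3 : (3 : GaussianInt) ∣ p * q := ⟨_, h⟩
  rcases prime_three.dvd_or_dvd h3 with ⟨p', rfl⟩ | ⟨q', rfl⟩
  · obtain ⟨e, f, a, b, he, hef, rfl, rfl, rfl⟩ := fourth_power_split_aux hz
      (hc.of_mul_left_right.symm) (mul_left_cancel₀ prime_three.ne_zero (by linear_combination h))
    refine ⟨e, f, a, b, he, hef, rfl, ?_, Or.inr ⟨rfl, rfl⟩⟩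
    exact (hc.symm.of_isCoprime_of_dvd_left ((dvd_pow_self a four_ne_zero).mul_left e)
      ).of_isCoprime_of_dvd_right (((dvd_pow_self b four_ne_zero).mul_left f).mul_left 3)
  · obtain ⟨e, f, a, b, he, hef, rfl, rfl, rfl⟩ := fourth_power_split_aux hz
      (hc.of_mul_right_right) (mul_left_cancel₀ prime_three.ne_zero (by linear_combination h))
    refine ⟨e, f, a, b, he, hef, rfl, ?_, Or.inl ⟨rfl, rfl⟩⟩
    exact (hc.of_isCoprime_of_dvd_left ((dvd_pow_self a four_ne_zero).mul_left e)
      ).of_isCoprime_of_dvd_right (((dvd_pow_self b four_ne_zero).mul_left f).mul_left 3)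

lemma pi_dvd_of_prime_dvd_two {l : GaussianInt} (hl : Prime l) (h : l ∣ 2) : pi ∣ l := by
  have h1 : l ∣ pi ^ 2 := h.trans ⟨I, pi_sq⟩
  exact hl.irreducible.dvd_symm prime_pi.irreducible (hl.dvd_of_dvd_pow h1)

lemma pi_dvd_two : pi ∣ 2 := by rw [pi_dvd_iff]; decide

lemma not_prime_dvd_of_isCoprime {u v l : GaussianInt} (hc : IsCoprime u v) (hl : Prime l)
    (hu : l ∣ u) (hv : l ∣ v) : False :=
  hl.not_isUnit (hc.isUnit_of_dvd' hu hv)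

/-! ### Descent from the quartic to its companion -/

/-- First half of the descent, with `v` odd. -/
lemma descent_fst_odd {u v w : GaussianInt} (hc : IsCoprime u v) (hv : ¬ pi ∣ v)
    (h : w ^ 2 = u ^ 4 - 3 * u ^ 2 * v ^ 2 + 3 * v ^ 4) :
    ∃ e s t, IsUnit e ∧ v = e * s * t ∧ IsCoprime s t ∧
      4 * (e * u) ^ 2 = s ^ 4 + 6 * s ^ 2 * t ^ 2 - 3 * t ^ 4 := by
  have hv0 : v ≠ 0 := by rintro rfl; exact hv (dvd_zero _)
  obtain ⟨e, f, s, t, he, hef, hst, hcst, hd⟩ : ∃ e f s t, IsUnit e ∧ e * f = 1 ∧ v = s * t ∧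
      IsCoprime s t ∧ 4 * u ^ 2 - 6 * v ^ 2 = e * s ^ 4 - 3 * (f * t ^ 4) := by
    obtain ⟨e, f, s, t, he, hef, hst, hcst, ⟨hp, hq⟩ | ⟨hp, hq⟩⟩ :=
      fourth_power_split (p := 2 * w + 2 * u ^ 2 - 3 * v ^ 2)
        (q := 2 * w - 2 * u ^ 2 + 3 * v ^ 2) hv0 (by linear_combination 4 * h) (by
        intro l hl hlv hlp hlq
        have h1 : l ∣ 2 ^ 2 * u ^ 2 := by
          have h2 := dvd_add (dvd_sub hlp hlq) ((hlv.mul_right v).mul_left 6)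
          exact h2.trans (dvd_of_eq (by ring))
        rcases hl.dvd_or_dvd h1 with h2 | h2
        · exact hv ((pi_dvd_of_prime_dvd_two hl (hl.dvd_of_dvd_pow h2)).trans hlv)
        · exact not_prime_dvd_of_isCoprime hc hl (hl.dvd_of_dvd_pow h2) hlv)
    · exact ⟨e, f, s, t, he, hef, hst, hcst, by linear_combination hp - hq⟩
    -- Swapping the factors flips the sign of their difference; the units absorb it.
    · exact ⟨-e, -f, s, t, he.neg, by linear_combination hef, hst, hcst,
        by linear_combination hp - hq⟩
  obtain ⟨γ, k, hγ, hk⟩ := odd_sq_mod_four hv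
  obtain ⟨α, i, hα, hi⟩ := pow_four_mod_four s
  obtain ⟨β, j, hβ, hj⟩ := pow_four_mod_four t
  -- For e = ±i the real part is 6γ = ±6, not divisible by 4.
  have h4 : 4 ∣ 6 * γ + e * α - 3 * (f * β) :=
    ⟨u ^ 2 - 6 * k - e * i + 3 * f * j, by linear_combination -6 * hk - hd - e * hi + 3 * f * hj⟩
  rcases unit_mul_eq_one_cases he hef with ⟨rfl, rfl⟩ | ⟨rfl, rfl⟩ | ⟨rfl, rfl⟩ | ⟨rfl, rfl⟩
  · exact ⟨1, s, t, isUnit_one, by rw [hst]; ring, hcst,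
      by linear_combination hd + 6 * (v + s * t) * hst⟩
  -- For e = -1, replacing s by is changes the sign of s^2 but not of s^4.
  · refine ⟨I, I * s, -t, isUnit_I, by linear_combination hst + s * t * I_sq, ?_, ?_⟩
    · exact (isCoprime_mul_unit_left_left isUnit_I s _).mpr hcst.neg_right
    · linear_combination -hd - 6 * (v + s * t) * hst + (4 * u ^ 2 - 6 * s ^ 2 * t ^ 2) * I_sq
        - s ^ 4 * (I ^ 2 - 1) * I_sq
  all_goals
    exfalso
    rw [four_dvd_iff] at h4
    revert h4
    rcases hα with rfl | rfl <;> rcases hβ with rfl | rfl <;> rcases hγ with rfl | rfl <;> decide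

/-- First half of the descent, with `v` even. -/
lemma descent_fst_even {u v w : GaussianInt} (hc : IsCoprime u v) (hv0 : v ≠ 0) (hv : pi ∣ v)
    (h : w ^ 2 = u ^ 4 - 3 * u ^ 2 * v ^ 2 + 3 * v ^ 4) :
    ∃ e s t, IsUnit e ∧ v = 2 * e * s * t ∧ IsCoprime s t ∧
      (e * u) ^ 2 = s ^ 4 + 6 * s ^ 2 * t ^ 2 - 3 * t ^ 4 := by
  have hu : ¬ pi ∣ u := fun hu => not_prime_dvd_of_isCoprime hc prime_pi hu hv
  have hw : ¬ pi ∣ w := by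
    intro hw
    apply hu
    apply prime_pi.dvd_of_dvd_pow (n := 4)
    have h1 : pi ∣ w * w - v * (-3 * u ^ 2 * v + 3 * v ^ 3) :=
      dvd_sub (hw.mul_right _) (hv.mul_right _)
    exact h1.trans (dvd_of_eq (by linear_combination h))
  obtain ⟨v₁, rfl⟩ := hv
  have hv₁ : pi ∣ v₁ := by
    by_contra hv₁
    obtain ⟨α, i, hα, hi⟩ := odd_sq_mod_four hw
    obtain ⟨β, j, hβ, hj⟩ := odd_sq_mod_four hu
    obtain ⟨γ, k, hγ, hk⟩ := odd_sq_mod_four hv₁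
    -- With v = (1+i)v₁ and v₁ odd, w^2 would be 1 + 2i modulo 4, not an odd square.
    have h4 : 4 ∣ α - β ^ 2 + 6 * I * β * γ := by
      have h' : w ^ 2 = (u ^ 2) ^ 2 - 6 * I * u ^ 2 * v₁ ^ 2 - 12 * (v₁ ^ 2) ^ 2 := by
        linear_combination h - 3 * u ^ 2 * v₁ ^ 2 * pi_sq
          + 3 * v₁ ^ 4 * (pi ^ 2 + 2 * I) * pi_sq + 12 * v₁ ^ 4 * I_sq
      rw [hi, hj, hk] at h'
      exact ⟨-i + 2 * β * j + 4 * j ^ 2 - 6 * I * (β * k + γ * j + 4 * j * k)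
        - 3 * (γ + 4 * k) ^ 2, by linear_combination h'⟩
    rw [four_dvd_iff] at h4
    revert h4
    rcases hα with rfl | rfl <;> rcases hβ with rfl | rfl <;> rcases hγ with rfl | rfl <;> decide
  obtain ⟨v₂, rfl⟩ := hv₁
  obtain ⟨z, hz⟩ : ∃ z, pi * (pi * v₂) = 2 * z := ⟨I * v₂, by linear_combination v₂ * pi_sq⟩
  rw [hz] at hc hv0 h ⊢
  have hz0 : z ≠ 0 := by rintro rfl; exact hv0 (mul_zero _)
  have hY : ¬ pi ∣ u ^ 2 - 6 * z ^ 2 := by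
    intro hY
    have h1 := dvd_add hY ((pi_dvd_two.mul_right (3 * z ^ 2)))
    exact hu (prime_pi.dvd_of_dvd_pow (n := 2) (h1.trans (dvd_of_eq (by ring))))
  -- With v = 2z, w^2 = (u^2-6z^2)^2 + 12z^4.
  obtain ⟨F, hF⟩ := two_dvd_sub_of_odd hw hY ⟨3 * z ^ 4, by linear_combination h⟩
  have hw' : w = 2 * F + (u ^ 2 - 6 * z ^ 2) := by linear_combination hF
  subst hw'
  have hFG : (F + (u ^ 2 - 6 * z ^ 2)) * F = 3 * z ^ 4 := by
    apply mul_left_cancel₀ (show (4 : GaussianInt) ≠ 0 by decide)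
    linear_combination h
  obtain ⟨e, f, s, t, he, hef, hst, hcst, hd⟩ : ∃ e f s t, IsUnit e ∧ e * f = 1 ∧ z = s * t ∧
      IsCoprime s t ∧ u ^ 2 - 6 * z ^ 2 = e * s ^ 4 - 3 * (f * t ^ 4) := by
    obtain ⟨e, f, s, t, he, hef, hst, hcst, ⟨hp, hq⟩ | ⟨hp, hq⟩⟩ :=
      fourth_power_split hz0 hFG (by
        intro l hl hlv hlp hlq
        have h1 : l ∣ u ^ 2 := by
          have h2 := dvd_add (dvd_sub hlp hlq) ((hlv.mul_right z).mul_left 6)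
          exact h2.trans (dvd_of_eq (by ring))
        exact not_prime_dvd_of_isCoprime hc hl (hl.dvd_of_dvd_pow h1) (hlv.mul_left 2))
    · exact ⟨e, f, s, t, he, hef, hst, hcst, by linear_combination hp - hq⟩
    · exact ⟨-e, -f, s, t, he.neg, by linear_combination hef, hst, hcst,
        by linear_combination hp - hq⟩
  obtain ⟨γ, k, hγ, hk⟩ := odd_sq_mod_four hu
  obtain ⟨α, i, hα, hi⟩ := pow_four_mod_four s
  obtain ⟨β, j, hβ, hj⟩ := pow_four_mod_four t
  have h4 : 2 ∣ γ - e * α + 3 * (f * β) :=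
    ⟨3 * z ^ 2 + 2 * (-k + e * i - 3 * f * j),
      by linear_combination -hk + hd + e * hi - 3 * f * hj⟩
  rcases unit_mul_eq_one_cases he hef with ⟨rfl, rfl⟩ | ⟨rfl, rfl⟩ | ⟨rfl, rfl⟩ | ⟨rfl, rfl⟩
  · exact ⟨1, s, t, isUnit_one, by rw [hst]; ring, hcst,
      by linear_combination hd + 6 * (z + s * t) * hst⟩
  · refine ⟨I, I * s, -t, isUnit_I, by linear_combination 2 * hst + 2 * s * t * I_sq, ?_, ?_⟩
    · exact (isCoprime_mul_unit_left_left isUnit_I s _).mpr hcst.neg_right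
    · linear_combination -hd - 6 * (z + s * t) * hst + (u ^ 2 - 6 * s ^ 2 * t ^ 2) * I_sq
        - s ^ 4 * (I ^ 2 - 1) * I_sq
  all_goals
    exfalso
    rw [two_dvd_iff] at h4
    revert h4
    rcases hα with rfl | rfl <;> rcases hβ with rfl | rfl <;> rcases hγ with rfl | rfl <;> decide

/-! ### Descent from the companion back to the quartic -/

/-- Second half of the descent, with `t` odd. -/
lemma descent_snd_odd {s t U : GaussianInt} (hc : IsCoprime s t) (hs : ¬ pi ∣ s) (ht : ¬ pi ∣ t)
    (h : 4 * U ^ 2 = s ^ 4 + 6 * s ^ 2 * t ^ 2 - 3 * t ^ 4) :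
    ∃ e a b, IsUnit e ∧ t = e * a * b ∧ IsCoprime a b ∧
      (e * s) ^ 2 = a ^ 4 - 3 * a ^ 2 * b ^ 2 + 3 * b ^ 4 := by
  have ht0 : t ≠ 0 := by rintro rfl; exact ht (dvd_zero _)
  obtain ⟨σ, k, hσ, hk⟩ := odd_sq_mod_four hs
  obtain ⟨τ, l, hτ, hl⟩ := odd_sq_mod_four ht
  obtain ⟨m, hm⟩ : 2 ∣ s ^ 2 + 3 * t ^ 2 := by
    have h2 : 2 ∣ σ + 3 * τ := by
      rw [two_dvd_iff]
      rcases hσ with rfl | rfl <;> rcases hτ with rfl | rfl <;> decide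
    obtain ⟨n, hn⟩ := h2
    exact ⟨n + 2 * k + 6 * l, by linear_combination hk + 3 * hl + hn⟩
  have hpq : (m - U) * (m + U) = 3 * t ^ 4 := by
    apply mul_left_cancel₀ (show (4 : GaussianInt) ≠ 0 by decide)
    linear_combination -h - (s ^ 2 + 3 * t ^ 2 + 2 * m) * hm
  obtain ⟨e, f, a, b, he, hef, hab, hcab, hd⟩ : ∃ e f a b, IsUnit e ∧ e * f = 1 ∧ t = a * b ∧
      IsCoprime a b ∧ s ^ 2 + 3 * t ^ 2 = e * a ^ 4 + 3 * (f * b ^ 4) := by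
    obtain ⟨e, f, a, b, he, hef, hab, hcab, hpq⟩ := fourth_power_split ht0 hpq (by
      intro l hl hlt hlp hlq
      have h1 : l ∣ s ^ 2 := by
        have h2 := dvd_sub (dvd_add hlp hlq) ((hlt.mul_right t).mul_left 3)
        exact h2.trans (dvd_of_eq (by linear_combination -hm))
      exact not_prime_dvd_of_isCoprime hc hl (hl.dvd_of_dvd_pow h1) hlt)
    refine ⟨e, f, a, b, he, hef, hab, hcab, ?_⟩
    rcases hpq with ⟨hp, hq⟩ | ⟨hp, hq⟩ <;> linear_combination hp + hq + hm
  obtain ⟨i, hi⟩ := odd_pow_four_mod_four (fun ha => ht (hab ▸ ha.mul_right b) : ¬ pi ∣ a)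
  obtain ⟨j, hj⟩ := odd_pow_four_mod_four (fun hb => ht (hab ▸ hb.mul_left a) : ¬ pi ∣ b)
  -- For e = ±i the imaginary part is ±2.
  have h4 : 4 ∣ σ + 3 * τ - e - 3 * f :=
    ⟨e * i + 3 * f * j - k - 3 * l,
      by linear_combination -hk - 3 * hl + hd + e * hi + 3 * f * hj⟩
  rcases unit_mul_eq_one_cases he hef with ⟨rfl, rfl⟩ | ⟨rfl, rfl⟩ | ⟨rfl, rfl⟩ | ⟨rfl, rfl⟩
  · exact ⟨1, a, b, isUnit_one, by rw [hab]; ring, hcab,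
      by linear_combination hd - 3 * (t + a * b) * hab⟩
  · refine ⟨I, I * a, -b, isUnit_I, by linear_combination hab + a * b * I_sq, ?_, ?_⟩
    · exact (isCoprime_mul_unit_left_left isUnit_I a _).mpr hcab.neg_right
    · linear_combination -hd + 3 * (t + a * b) * hab + (s ^ 2 + 3 * a ^ 2 * b ^ 2) * I_sq
        - a ^ 4 * (I ^ 2 - 1) * I_sq
  all_goals
    exfalso
    rw [four_dvd_iff] at h4
    revert h4
    rcases hσ with rfl | rfl <;> rcases hτ with rfl | rfl <;> decide

/-- Second half of the descent, with `t` even. -/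
lemma descent_snd_even {s t U : GaussianInt} (hc : IsCoprime s t) (ht0 : t ≠ 0) (hU : ¬ pi ∣ U)
    (h : U ^ 2 = s ^ 4 + 6 * s ^ 2 * t ^ 2 - 3 * t ^ 4) :
    pi ∣ t ∧ ∃ e a b, IsUnit e ∧ t = e * a * b ∧ IsCoprime a b ∧
      (e * s) ^ 2 = a ^ 4 - 3 * a ^ 2 * b ^ 2 + 3 * b ^ 4 := by
  have hM : ¬ pi ∣ s ^ 2 + 3 * t ^ 2 := by
    intro hM
    have h1 := dvd_sub (hM.mul_right (s ^ 2 + 3 * t ^ 2)) (pi_dvd_two.mul_right (6 * t ^ 4))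
    exact hU (prime_pi.dvd_of_dvd_pow (n := 2) (h1.trans (dvd_of_eq (by linear_combination -h))))
  obtain ⟨F, hF⟩ := two_dvd_sub_of_odd hM hU ⟨3 * t ^ 4, by linear_combination -h⟩
  have hpq : F * (F + U) = 3 * t ^ 4 := by
    apply mul_left_cancel₀ (show (4 : GaussianInt) ≠ 0 by decide)
    linear_combination -h - (s ^ 2 + 3 * t ^ 2 + 2 * F + U) * hF
  -- U is odd, so one of F and F + U is even.
  have hpit : pi ∣ t := by
    have h1 : pi ∣ F * (F + U) := by
      rw [pi_dvd_iff] at hU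
      rcases Int.emod_two_eq_zero_or_one (F.re + F.im) with h0 | h0
      · exact Dvd.dvd.mul_right ((pi_dvd_iff F).mpr h0) _
      · refine Dvd.dvd.mul_left ((pi_dvd_iff _).mpr ?_) _
        simp only [Zsqrtd.re_add, Zsqrtd.im_add]
        omega
    rw [hpq] at h1
    rcases prime_pi.dvd_or_dvd h1 with h2 | h2
    · rw [pi_dvd_iff] at h2
      exact absurd h2 (by decide)
    · exact prime_pi.dvd_of_dvd_pow h2
  refine ⟨hpit, ?_⟩
  have hs : ¬ pi ∣ s := fun hs => not_prime_dvd_of_isCoprime hc prime_pi hs hpit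
  obtain ⟨e, f, a, b, he, hef, hab, hcab, hd⟩ : ∃ e f a b, IsUnit e ∧ e * f = 1 ∧ t = a * b ∧
      IsCoprime a b ∧ s ^ 2 + 3 * t ^ 2 = e * a ^ 4 + 3 * (f * b ^ 4) := by
    obtain ⟨e, f, a, b, he, hef, hab, hcab, hpq⟩ := fourth_power_split ht0 hpq (by
      intro l hl hlt hlp hlq
      have h1 : l ∣ s ^ 2 := by
        have h2 := dvd_sub (dvd_add hlp hlq) ((hlt.mul_right t).mul_left 3)
        exact h2.trans (dvd_of_eq (by linear_combination -hF))
      exact not_prime_dvd_of_isCoprime hc hl (hl.dvd_of_dvd_pow h1) hlt)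
    refine ⟨e, f, a, b, he, hef, hab, hcab, ?_⟩
    rcases hpq with ⟨hp, hq⟩ | ⟨hp, hq⟩ <;> linear_combination hp + hq + hF
  obtain ⟨σ, k, hσ, hk⟩ := odd_sq_mod_four hs
  obtain ⟨t', ht'⟩ := hpit
  obtain ⟨α, i, hα, hi⟩ := pow_four_mod_four a
  obtain ⟨β, j, hβ, hj⟩ := pow_four_mod_four b
  have h4 : 2 ∣ σ - e * α - 3 * (f * β) :=
    ⟨2 * (e * i + 3 * f * j - k) - 3 * I * t' ^ 2, by
      linear_combination -hk + hd + e * hi + 3 * f * hj - 3 * (t + pi * t') * ht'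
        - 3 * t' ^ 2 * pi_sq⟩
  rcases unit_mul_eq_one_cases he hef with ⟨rfl, rfl⟩ | ⟨rfl, rfl⟩ | ⟨rfl, rfl⟩ | ⟨rfl, rfl⟩
  · exact ⟨1, a, b, isUnit_one, by rw [hab]; ring, hcab,
      by linear_combination hd - 3 * (t + a * b) * hab⟩
  · refine ⟨I, I * a, -b, isUnit_I, by linear_combination hab + a * b * I_sq, ?_, ?_⟩
    · exact (isCoprime_mul_unit_left_left isUnit_I a _).mpr hcab.neg_right
    · linear_combination -hd + 3 * (t + a * b) * hab + (s ^ 2 + 3 * a ^ 2 * b ^ 2) * I_sq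
        - a ^ 4 * (I ^ 2 - 1) * I_sq
  all_goals
    exfalso
    rw [two_dvd_iff] at h4
    revert h4
    rcases hα with rfl | rfl <;> rcases hβ with rfl | rfl <;> rcases hσ with rfl | rfl <;> decide

/-! ### Solving the quartic -/

lemma isUnit_of_isCoprime_of_sq_eq {a b : GaussianInt} (hc : IsCoprime a b)
    (h : a ^ 2 = b ^ 2) : IsUnit a :=
  isUnit_of_dvd_unit (dvd_pow_self a two_ne_zero)
    ((hc.pow_right (n := 2)).pow_left (m := 2) |>.isUnit_of_dvd' dvd_rfl (dvd_of_eq h))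

/-- Base case of the descent: W^2 = 1 leaves 3b^2(a^2-b^2) = 0, while W^2 = -1 would make 3 divide
2. -/
lemma sq_eq_sq_of_isUnit {a b W : GaussianInt} (ha : IsUnit a) (hW : IsUnit W) (hb : b ≠ 0)
    (h : W ^ 2 = a ^ 4 - 3 * a ^ 2 * b ^ 2 + 3 * b ^ 4) : a ^ 2 = b ^ 2 := by
  rw [IsUnit.pow_four ha] at h
  rcases IsUnit.sq_eq hW with h1 | h1
  · have : 3 * b ^ 2 * (a ^ 2 - b ^ 2) = 0 := by linear_combination h - h1
    rcases mul_eq_zero.mp this with h2 | h2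
    · exact absurd h2 (mul_ne_zero prime_three.ne_zero (pow_ne_zero 2 hb))
    · exact sub_eq_zero.mp h2
  · have h2 : (2 : GaussianInt) = 3 * (a ^ 2 * b ^ 2 - b ^ 4) := by linear_combination h1 - h
    have h3 : ((3 : ℤ) : GaussianInt) ∣ 2 := Dvd.intro _ h2.symm
    exact absurd ((Zsqrtd.intCast_dvd 3 2).mp h3).1 (by decide)

/-- The only coprime solutions of `w ^ 2 = u ^ 4 - 3 u ^ 2 v ^ 2 + 3 v ^ 4` in Gaussian integers
are the obvious ones. -/
theorem quartic_solutions {u v w : GaussianInt} (hc : IsCoprime u v)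
    (h : w ^ 2 = u ^ 4 - 3 * u ^ 2 * v ^ 2 + 3 * v ^ 4) : v = 0 ∨ u ^ 2 = v ^ 2 := by
  induction v using WellFounded.induction
    (wellFounded_dvdNotUnit (α := GaussianInt)) generalizing u w with
  | _ v ih =>
  by_cases hv0 : v = 0
  · exact Or.inl hv0
  right
  by_cases hv : pi ∣ v
  · exfalso
    have hu : ¬ pi ∣ u := fun hu => not_prime_dvd_of_isCoprime hc prime_pi hu hv
    obtain ⟨e, s, t, he, rfl, hst, h1⟩ := descent_fst_even hc hv0 hv h
    have ht0 : t ≠ 0 := by rintro rfl; exact hv0 (mul_zero _)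
    have heu : ¬ pi ∣ e * u := fun hd => (prime_pi.dvd_or_dvd hd).elim
      (fun h2 => not_isUnit_pi (isUnit_of_dvd_unit h2 he)) hu
    obtain ⟨hpit, e', a, b, he', rfl, hab, h2⟩ := descent_snd_even hst ht0 heu h1
    have hb0 : b ≠ 0 := by rintro rfl; exact ht0 (mul_zero _)
    have hlt : DvdNotUnit b (2 * e * s * (e' * a * b)) := by
      refine ⟨hb0, 2 * e * s * (e' * a), fun hu2 => ?_, by ring⟩
      exact not_isUnit_pi (isUnit_of_dvd_unit
        (((pi_dvd_two.mul_right e).mul_right s).mul_right (e' * a)) hu2)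
    -- A solution with a^2 = b^2 makes a and b units, hence t a unit, although 1+i divides t.
    rcases ih b hlt hab h2 with h3 | h3
    · exact hb0 h3
    · have ha := isUnit_of_isCoprime_of_sq_eq hab h3
      have hb := isUnit_of_isCoprime_of_sq_eq hab.symm h3.symm
      exact not_isUnit_pi (isUnit_of_dvd_unit hpit ((he'.mul ha).mul hb))
  · obtain ⟨e, s, t, he, rfl, hst, h1⟩ := descent_fst_odd hc hv h
    have hs : ¬ pi ∣ s := fun hs => hv ((hs.mul_left e).mul_right t)
    have ht : ¬ pi ∣ t := fun ht => hv (ht.mul_left _)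
    obtain ⟨e', a, b, he', rfl, hab, h2⟩ := descent_snd_odd hst hs ht h1
    have hb0 : b ≠ 0 := by rintro rfl; exact hv0 (by ring)
    have h3 : a ^ 2 = b ^ 2 := by
      -- If the cofactor of b in v is a unit, the descent is not strict and the base case applies.
      by_cases hunit : IsUnit (e * s * (e' * a))
      · have h4 := isUnit_of_mul_isUnit_left hunit
        have h5 := isUnit_of_mul_isUnit_right hunit
        exact sq_eq_sq_of_isUnit (isUnit_of_mul_isUnit_right h5)
          (he'.mul (isUnit_of_mul_isUnit_right h4)) hb0 h2
      · exact (ih b ⟨hb0, _, hunit, by ring⟩ hab h2).resolve_left hb0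
    have ha4 := IsUnit.pow_four (isUnit_of_isCoprime_of_sq_eq hab h3)
    -- Climb back: s^2 = t^2 = e'^2, so 4(eu)^2 = 1 + 6 - 3 = 4.
    have hs1 : (e' * s) ^ 2 = 1 := by
      linear_combination h2 + ha4 + 3 * b ^ 2 * (-h3)
    have he'4 := IsUnit.pow_four he'
    have hs2 : s ^ 2 = e' ^ 2 := by linear_combination e' ^ 2 * hs1 - s ^ 2 * he'4
    have ht2 : (e' * a * b) ^ 2 = e' ^ 2 := by
      linear_combination e' ^ 2 * ha4 - e' ^ 2 * a ^ 2 * h3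
    have h5 : (e * u) ^ 2 = 1 := by
      apply mul_left_cancel₀ (show (4 : GaussianInt) ≠ 0 by decide)
      rw [h1]
      linear_combination 4 * he'4 + (s ^ 2 + e' ^ 2 + 6 * e' ^ 2) * hs2
        + (6 * s ^ 2 - 3 * ((e' * a * b) ^ 2 + e' ^ 2)) * ht2
    have he4 := IsUnit.pow_four he
    linear_combination e ^ 2 * h5 - u ^ 2 * he4 - e ^ 2 * he'4 - e ^ 2 * e' ^ 2 * hs2
      - e ^ 2 * s ^ 2 * ht2

/-! ### From the cubic equations to the quartic -/

lemma sq_mod_four (s : GaussianInt) :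
    ∃ c k, (c = 0 ∨ c = 2 * I ∨ c = 1 ∨ c = -1) ∧ s ^ 2 = c + 4 * k := by
  by_cases hs : pi ∣ s
  · obtain ⟨t, rfl⟩ := hs
    by_cases ht : pi ∣ t
    · obtain ⟨r, rfl⟩ := ht
      exact ⟨0, -r ^ 2, Or.inl rfl, by
        linear_combination (pi ^ 2 + 2 * I) * r ^ 2 * pi_sq + 4 * r ^ 2 * I_sq⟩
    · obtain ⟨_, k, rfl | rfl, h⟩ := odd_sq_mod_four ht
      · exact ⟨2 * I, 2 * I * k, Or.inr (Or.inl rfl), by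
          linear_combination t ^ 2 * pi_sq + 2 * I * h⟩
      · exact ⟨2 * I, 2 * I * k - I, Or.inr (Or.inl rfl), by
          linear_combination t ^ 2 * pi_sq + 2 * I * h⟩
  · obtain ⟨c, k, hc, h⟩ := odd_sq_mod_four hs
    exact ⟨c, k, Or.inr (Or.inr hc), h⟩

/-- The integral points of `x ^ 2 = y ^ 3 + 1` over the Gaussian integers with `x ≠ 0`. -/
theorem eq_zero_or_eq_two_of_sq_eq_cube_add_one {x y : GaussianInt} (hx : x ≠ 0)
    (h : x ^ 2 = y ^ 3 + 1) : y = 0 ∨ y = 2 := by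
  by_cases h3 : 3 ∣ y + 1
  · obtain ⟨p, hp⟩ := h3
    obtain rfl : y = 3 * p - 1 := by linear_combination hp
    obtain ⟨z, rfl⟩ : 3 ∣ x := prime_three.dvd_of_dvd_pow (n := 2)
      ⟨3 * (p * (3 * p ^ 2 - 3 * p + 1)), by linear_combination h⟩
    have hpq : p * (3 * p ^ 2 - 3 * p + 1) = z ^ 2 := by
      apply mul_left_cancel₀ (pow_ne_zero 2 prime_three.ne_zero)
      linear_combination -h
    have hz : z ≠ 0 := by rintro rfl; exact hx (mul_zero _)
    obtain ⟨a, b, ⟨rfl, hb⟩ | ⟨rfl, hb⟩⟩ := sq_split hz ⟨3 - 3 * p, 1, by ring⟩ hpq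
    · rcases quartic_solutions (u := 1) (v := a) (w := b) isCoprime_one_left
        (by linear_combination -hb) with rfl | h1
      · exact absurd (pow_eq_zero_iff two_ne_zero |>.mp (by rw [← hpq]; ring)) hz
      · right
        linear_combination -3 * h1
    · exfalso
      obtain ⟨c, k, hc, hk⟩ := sq_mod_four a
      obtain ⟨d, l, hd, hl⟩ := sq_mod_four b
      have h4 : 4 ∣ 3 * (I * c) ^ 2 - 3 * (I * c) + 1 - I * d := by
        rw [hk, hl] at hb
        exact ⟨-6 * I ^ 2 * c * k - 12 * I ^ 2 * k ^ 2 + 3 * I * k + I * l,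
          by linear_combination hb⟩
      rw [four_dvd_iff] at h4
      revert h4
      rcases hc with rfl | rfl | rfl | rfl <;> rcases hd with rfl | rfl | rfl | rfl <;> decide
  -- Here y^2 - y + 1 = 3 + (y+1)(y-2), so a common prime would divide 3.
  · have hco : IsCoprime (y + 1) (y ^ 2 - y + 1) := by
      have h1 : IsCoprime (y + 1) 3 :=
        ((prime_three.irreducible.coprime_iff_not_dvd).mpr h3).symm
      have h2 := h1.add_mul_left_right (y - 2)
      rwa [show 3 + (y + 1) * (y - 2) = y ^ 2 - y + 1 by ring] at h2
    obtain ⟨a, b, ⟨ha, hb⟩ | ⟨ha, hb⟩⟩ := sq_split hx hco (by linear_combination -h)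
    all_goals obtain rfl := eq_sub_of_add_eq ha
    · rcases quartic_solutions (u := a) (v := 1) (w := b) isCoprime_one_right
        (by linear_combination -hb) with h1 | h1
      · exact absurd h1 one_ne_zero
      · left
        linear_combination h1
    · exfalso
      obtain ⟨c, k, hc, hk⟩ := sq_mod_four a
      obtain ⟨d, l, hd, hl⟩ := sq_mod_four b
      have h4 : 4 ∣ (I * c) ^ 2 - 3 * (I * c) + 3 - I * d := by
        rw [hk, hl] at hb
        exact ⟨-2 * I ^ 2 * c * k - 4 * I ^ 2 * k ^ 2 + 3 * I * k + I * l,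
          by linear_combination hb⟩
      rw [four_dvd_iff] at h4
      revert h4
      rcases hc with rfl | rfl | rfl | rfl <;> rcases hd with rfl | rfl | rfl | rfl <;> decide

lemma eq_neg_one_of_cube_add_one_eq_zero {y : GaussianInt} (h : y ^ 3 + 1 = 0) : y = -1 := by
  have h1 : (y + 1) * (y ^ 2 - y + 1) = 0 := by linear_combination h
  rcases mul_eq_zero.mp h1 with h2 | h2
  · linear_combination h2
  · exfalso
    obtain ⟨a, b⟩ := y
    have hre := congrArg Zsqrtd.re h2
    have him := congrArg Zsqrtd.im h2
    simp [sq, Zsqrtd.re_mul, Zsqrtd.im_mul] at hre him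
    -- The imaginary part forces b = 0, and a^2 - a + 1 has no integer root.
    have h3 : b * (2 * a - 1) = 0 := by linear_combination him
    rcases mul_eq_zero.mp h3 with rfl | h4
    · nlinarith [sq_nonneg (2 * a - 1)]
    · omega

lemma nontrivial_solutions {x y : GaussianInt} :
    (x ^ 2 - y ^ 3 = 1 ∧ x * y ≠ 0) ↔ (x = 3 ∨ x = -3) ∧ y = 2 := by
  constructor
  · rintro ⟨h, hxy⟩
    have hy := (eq_zero_or_eq_two_of_sq_eq_cube_add_one (left_ne_zero_of_mul hxy)
      (by linear_combination h)).resolve_left (right_ne_zero_of_mul hxy)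
    subst hy
    exact ⟨sq_eq_sq_iff_eq_or_eq_neg.mp (by linear_combination h), rfl⟩
  · rintro ⟨rfl | rfl, rfl⟩ <;> decide

end GaussianInt

open GaussianInt in
theorem mainTheorem5 :
    -- every solution of `x ^ 2 - y ^ 3 = 1` in Gaussian integers is a pair of rational integers
    (∀ x y : GaussianInt, x ^ 2 - y ^ 3 = 1 → ∃ a b : ℤ, x = (a : GaussianInt) ∧ y = (b : GaussianInt)) ∧
    -- its nontrivial solutions are `(3, 2)` and `(-3, 2)`
    {s : GaussianInt × GaussianInt | s.1 ^ 2 - s.2 ^ 3 = 1 ∧ s.1 * s.2 ≠ 0} =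
      {(3, 2), (-3, 2)} ∧
    -- the nontrivial solutions of `x ^ 3 - y ^ 2 = 1` are `(-2, 3i)` and `(-2, -3i)`
    {s : GaussianInt × GaussianInt | s.1 ^ 3 - s.2 ^ 2 = 1 ∧ s.1 * s.2 ≠ 0} =
      {(-2, ⟨0, 3⟩), (-2, ⟨0, -3⟩)} := by
  refine ⟨fun x y h => ?_, ?_, ?_⟩
  · by_cases hx : x = 0
    · subst hx
      have hy := eq_neg_one_of_cube_add_one_eq_zero (y := y) (by linear_combination -h)
      exact ⟨0, -1, by simp, by simp [hy]⟩
    by_cases hy : y = 0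
    · subst hy
      have h1 : x ^ 2 = 1 := by linear_combination h
      rcases sq_eq_sq_iff_eq_or_eq_neg.mp (h1.trans (one_pow 2).symm) with rfl | rfl
      · exact ⟨1, 0, by simp, by simp⟩
      · exact ⟨-1, 0, by simp, by simp⟩
    · obtain ⟨rfl | rfl, rfl⟩ := nontrivial_solutions.mp ⟨h, mul_ne_zero hx hy⟩
      · exact ⟨3, 2, by decide, by decide⟩
      · exact ⟨-3, 2, by decide, by decide⟩
  · ext ⟨x, y⟩
    simp only [Set.mem_ofPred_eq, Set.mem_insert_iff, Set.mem_singleton_iff, Prod.mk.injEq]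
    rw [nontrivial_solutions]
    tauto
  · ext ⟨x, y⟩
    simp only [Set.mem_ofPred_eq, Set.mem_insert_iff, Set.mem_singleton_iff, Prod.mk.injEq]
    constructor
    · rintro ⟨h, hxy⟩
      obtain ⟨h1, h2⟩ := (nontrivial_solutions (x := I * y) (y := -x)).mp
        ⟨by linear_combination h + y ^ 2 * I_sq, mul_ne_zero
          (mul_ne_zero isUnit_I.ne_zero (right_ne_zero_of_mul hxy))
          (neg_ne_zero.mpr (left_ne_zero_of_mul hxy))⟩
      have hx : x = -2 := by linear_combination -h2
      have e3 : (⟨0, 3⟩ : GaussianInt) = 3 * I := by decide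
      have e3' : (⟨0, -3⟩ : GaussianInt) = -3 * I := by decide
      rw [e3, e3']
      rcases h1 with h1 | h1
      · exact Or.inr ⟨hx, by linear_combination -I * h1 + y * I_sq⟩
      · exact Or.inl ⟨hx, by linear_combination -I * h1 + y * I_sq⟩
    · rintro (⟨rfl, rfl⟩ | ⟨rfl, rfl⟩) <;> decide
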